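/- All graphs are finite and simple. A burning process of a connected graph $G$ starts with all vertices unburned. In each round $r\ge 1$ one chooses a vertex $x_r$ that is not burned at the end of round $r-1$ (the source of round $r$), and burns $x_r$ together with all unburned vertices that are adjacent to some vertex burned by the end of round $r-1$; burned vertices remain burned. The process terminates when all vertices are burned. If it terminates in $k$ rounds, $(x_1,\dots,x_k)$ is a burning sequence for $G$ of length $k$. The burning number $b(G)$ is the minimum length of a burning sequence for $G$. Theorem. Let $T$ be a tree of order $n$ with $n_2$ vertices of degree $2$. Then $$b(T)\le \left\lceil \left(n+n_2-\left\lceil\sqrt{n+n_2+0.25}-1.5\right\rceil\right)^{\frac12}\right\rceil.$$ -/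

import Mathlib

/-- The set of vertices of `G` that are burned at the end of round `r`, where `s[r]` is the source
of round `r + 1` (so a list lists the sources of rounds `1, 2, …`). In round `r + 1` the source of
that round is burned together with every neighbour of a vertex that was burned by the end of
round `r`; burned vertices remain burned. -/
def SimpleGraph.burnedAfter {V : Type*} (G : SimpleGraph V) (s : List V) : ℕ → Set V
  | 0 => ∅
  | r + 1 => {v | v ∈ G.burnedAfter s r ∨ s[r]? = some v ∨ ∃ u ∈ G.burnedAfter s r, G.Adj u v}

/-- `s` is a burning sequence for `G`: every source is still unburned at the beginning of the round
in which it is chosen, and all vertices are burned at the end of the last round. (As every round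
has an unburned source, not all vertices are burned before the last round.) -/
def SimpleGraph.IsBurningSequence {V : Type*} (G : SimpleGraph V) (s : List V) : Prop :=
  (∀ (r : ℕ) (hr : r < s.length), s[r] ∉ G.burnedAfter s r) ∧
    G.burnedAfter s s.length = Set.univ

/-- The burning number of `G`: the minimum length of a burning sequence for `G`. -/
noncomputable def SimpleGraph.burningNumber {V : Type*} (G : SimpleGraph V) : ℕ :=
  sInf {k : ℕ | ∃ s : List V, G.IsBurningSequence s ∧ s.length = k}

theorem SimpleGraph.burnedAfter_append {V : Type*} (G : SimpleGraph V) (s t : List V) :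
    ∀ r : ℕ, r ≤ s.length → G.burnedAfter (s ++ t) r = G.burnedAfter s r
  | 0, _ => rfl
  | r + 1, h => by
    have ih := G.burnedAfter_append s t r (by omega)
    have h' : (s ++ t)[r]? = s[r]? := List.getElem?_append_left (by omega)
    simp only [SimpleGraph.burnedAfter, ih, h']

/-- A finite graph has a burning sequence, so the minimum defining the burning number is
attained. -/
theorem SimpleGraph.exists_isBurningSequence_length_eq {V : Type*} [Finite V]
    (G : SimpleGraph V) :
    ∃ s : List V, G.IsBurningSequence s ∧ s.length = G.burningNumber := by
  have key : ∀ (n : ℕ) (s : List V),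
      (∀ (r : ℕ) (hr : r < s.length), s[r] ∉ G.burnedAfter s r) →
      (G.burnedAfter s s.length)ᶜ.ncard ≤ n → ∃ t : List V, G.IsBurningSequence t := by
    intro n
    induction n with
    | zero =>
      intro s hs hc
      refine ⟨s, hs, ?_⟩
      have h0 := (Set.ncard_eq_zero (Set.toFinite _)).1 (Nat.le_zero.1 hc)
      simpa using h0
    | succ n ih =>
      intro s hs hc
      by_cases hu : G.burnedAfter s s.length = Set.univ
      · exact ⟨s, hs, hu⟩
      obtain ⟨x, hx⟩ := (Set.ne_univ_iff_exists_notMem _).1 hu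
      refine ih (s ++ [x]) ?_ ?_
      · intro r hr
        have hr' : r ≤ s.length := by
          simp only [List.length_append, List.length_singleton] at hr
          omega
        rw [G.burnedAfter_append s [x] r hr']
        rcases hr'.lt_or_eq with h | h
        · rw [List.getElem_append_left h]
          exact hs r h
        · subst h
          simpa using hx
      · have hlt : (G.burnedAfter (s ++ [x]) (s ++ [x]).length)ᶜ.ncard <
            (G.burnedAfter s s.length)ᶜ.ncard := by
          apply Set.ncard_lt_ncard _ (Set.toFinite _)
          rw [compl_lt_compl_iff_lt, Set.ssubset_iff_exists]
          simp only [List.length_append, List.length_singleton, SimpleGraph.burnedAfter,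
            G.burnedAfter_append s [x] s.length le_rfl]
          exact ⟨fun v hv => Or.inl hv, x, Or.inr (Or.inl (by simp)), hx⟩
        omega
  obtain ⟨t, ht⟩ := key _ [] (by simp) le_rfl
  exact Nat.sInf_mem (s := {k : ℕ | ∃ s : List V, G.IsBurningSequence s ∧ s.length = k})
    ⟨t.length, t, ht, rfl⟩

/-!
Burning in `k` rounds amounts to covering the graph by balls of radii `0, 1, …, k - 1`. A connected
graph that is not a single ball of radius `r` splits into a connected part and at least `r + 1`
vertices lying in a ball of radius `r`: walk `r` steps back towards a root from a vertex at maximal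
distance from it, and cut off everything behind the vertex reached. A ball of radius `R` can even
absorb a whole connected graph with `2 * R + 1` vertices, so cutting off balls of radii
`j - 1, …, 1, 0` and covering what remains by a ball of radius `j` handles
`j * (j + 1) / 2 + (2 * j + 1)` vertices.

In a connected graph of order at least three, the vertices of degree at least two form a connected
dominating set, which has to be covered by balls whose radii are one smaller. By the degree sum, a
tree of order `n ≥ 2` has at most `(n + n₂ - 2) / 2` such vertices, so `k` rounds suffice as soon as
`n + n₂ < k * (k + 1)`, and the bound of the theorem is the least such `k`.
-/

namespace GraphBurning

open SimpleGraph

variable {V : Type*} {G : SimpleGraph V}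

section BurningSequences

theorem monotone_burnedAfter (G : SimpleGraph V) (s : List V) : Monotone (G.burnedAfter s) :=
  monotone_nat_of_le_succ fun _ _ hv => Or.inl hv

theorem mem_burnedAfter_add_length {s : List V} {r : ℕ} {u v : V} (p : G.Walk u v)
    (hu : u ∈ G.burnedAfter s r) : v ∈ G.burnedAfter s (r + p.length) := by
  induction p generalizing r with
  | nil => exact hu
  | cons hadj p ih =>
    rw [Walk.length_cons, Nat.add_left_comm, Nat.add_comm]
    exact ih (Or.inr (Or.inr ⟨_, hu, hadj⟩))

theorem burningNumber_le_length {s : List V} (hs : G.IsBurningSequence s) :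
    G.burningNumber ≤ s.length :=
  Nat.sInf_le ⟨s, hs, rfl⟩

/-- The first half of `SimpleGraph.IsBurningSequence`: the list `s` records the sources of the first
`s.length` rounds of a burning process that need not have terminated. -/
def IsPartialBurningSequence (G : SimpleGraph V) (s : List V) : Prop :=
  ∀ (r : ℕ) (hr : r < s.length), s[r] ∉ G.burnedAfter s r

theorem IsPartialBurningSequence.append_singleton {s : List V} {x : V}
    (hs : IsPartialBurningSequence G s) (hx : x ∉ G.burnedAfter s s.length) :
    IsPartialBurningSequence G (s ++ [x]) := by
  intro r hr
  rw [List.length_append, List.length_singleton, Nat.lt_succ_iff] at hr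
  rw [G.burnedAfter_append s [x] r hr]
  obtain hlt | rfl := hr.lt_or_eq
  · rw [List.getElem_append_left hlt]
    exact hs r hlt
  · rwa [List.getElem_concat_length rfl]

/-- Use `c r` as the source of round `r + 1`, unless it is already burned by then. -/
theorem exists_isPartialBurningSequence (c : ℕ → V) {k : ℕ} (hk : k ≤ G.burningNumber) :
    ∃ s : List V, s.length = k ∧ IsPartialBurningSequence G s ∧
      ∀ r < k, c r ∈ G.burnedAfter s (r + 1) := by
  induction k with
  | zero => exact ⟨[], rfl, by simp [IsPartialBurningSequence], by simp⟩
  | succ k ih =>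
    obtain ⟨s, rfl, hs, hc⟩ := ih (Nat.le_of_succ_le hk)
    have hunburned : G.burnedAfter s s.length ≠ Set.univ := fun huniv =>
      hk.not_gt (Nat.lt_succ_of_le (burningNumber_le_length ⟨hs, huniv⟩))
    obtain ⟨x, hx, hcx⟩ : ∃ x ∉ G.burnedAfter s s.length,
        c s.length ∈ G.burnedAfter s s.length ∨ x = c s.length := by
      by_cases h : c s.length ∈ G.burnedAfter s s.length
      · obtain ⟨x, hx⟩ := (Set.ne_univ_iff_exists_notMem _).1 hunburned
        exact ⟨x, hx, Or.inl h⟩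
      · exact ⟨c s.length, h, Or.inr rfl⟩
    refine ⟨s ++ [x], by simp, hs.append_singleton hx, fun r hr => ?_⟩
    obtain hlt | rfl := (Nat.lt_succ_iff.1 hr).lt_or_eq
    · rw [G.burnedAfter_append s [x] _ hlt]
      exact hc r hlt
    · obtain hburned | rfl := hcx
      · rw [← G.burnedAfter_append s [x] _ le_rfl] at hburned
        exact Or.inl hburned
      · exact Or.inr (Or.inl List.getElem?_concat_length)

theorem burningNumber_le_of_ball_cover (hG : G.Connected) {k : ℕ} (c : ℕ → V)
    (hc : ∀ v, ∃ i < k, G.dist (c i) v ≤ i) : G.burningNumber ≤ k := by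
  by_contra! hk
  obtain ⟨s, rfl, hs, hsources⟩ :=
    exists_isPartialBurningSequence (fun r => c (k - 1 - r)) hk.le
  refine hk.not_ge (burningNumber_le_length ⟨hs, Set.eq_univ_of_forall fun v => ?_⟩)
  obtain ⟨i, hi, hv⟩ := hc v
  obtain ⟨p, hp⟩ := hG.exists_walk_length_eq_dist (c i) v
  have hci : c i ∈ G.burnedAfter s (s.length - 1 - i + 1) := by
    have := hsources (s.length - 1 - i) (by omega)
    rwa [show s.length - 1 - (s.length - 1 - i) = i by omega] at this
  exact monotone_burnedAfter G s (by omega) (mem_burnedAfter_add_length p hci)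

end BurningSequences

section BallCovers

theorem dist_lt_card [Finite V] (hG : G.Connected) (u v : V) : G.dist u v < Nat.card V := by
  have := Fintype.ofFinite V
  obtain ⟨p, hp, hlen⟩ := hG.exists_path_of_dist u v
  rw [← hlen, Nat.card_eq_fintype_card]
  exact hp.length_lt

theorem dist_le_dist_induce {S : Set V} (hS : (G.induce S).Connected) (u v : S) :
    G.dist u v ≤ (G.induce S).dist u v := by
  obtain ⟨p, hp⟩ := hS.exists_walk_length_eq_dist u v
  rw [← hp, ← p.length_map (Embedding.induce S).toHom]
  exact dist_le _

theorem dist_le_dist_add_one (hG : G.Connected) {u v : V} (h : G.Adj u v) (w : V) :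
    G.dist u w ≤ G.dist v w + 1 := by
  have := hG.dist_triangle (u := u) (v := v) (w := w)
  rw [dist_eq_one_iff_adj.2 h] at this
  omega

theorem exists_adj_dist_add_one_eq (hG : G.Connected) {x w : V} (hw : w ≠ x) :
    ∃ u, G.Adj u w ∧ G.dist x u + 1 = G.dist x w := by
  obtain ⟨p, hp⟩ := hG.exists_walk_length_eq_dist w x
  cases p with
  | nil => exact absurd rfl hw
  | @cons _ u _ hadj p =>
    refine ⟨u, hadj.symm, ?_⟩
    have hle := dist_le p
    have htri := dist_le_dist_add_one hG hadj x
    rw [Walk.length_cons] at hp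
    rw [G.dist_comm (u := x), G.dist_comm (u := x)]
    omega

theorem connected_induce_of_exists_adj_dist_lt {S : Set V} {x : V} (hx : x ∈ S)
    (hS : ∀ w ∈ S, w ≠ x → ∃ u ∈ S, G.Adj u w ∧ G.dist x u < G.dist x w) :
    (G.induce S).Connected := by
  refine (connected_iff_exists_forall_reachable _).2 ⟨⟨x, hx⟩, fun w => ?_⟩
  induction h : G.dist x w using Nat.strong_induction_on generalizing w with
  | _ d ih =>
    by_cases hwx : (w : V) = x
    · obtain rfl : w = ⟨x, hx⟩ := Subtype.ext hwx
      exact Reachable.refl _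
    · obtain ⟨u, hu, hadj, hlt⟩ := hS w w.2 hwx
      exact (ih _ (h ▸ hlt) ⟨u, hu⟩ rfl).trans (Adj.reachable hadj)

/-- The shadow of `v` seen from `x`: all vertices `w` such that `v` lies on a geodesic from `x` to
`w`. In a tree rooted at `x` these are the descendants of `v`, including `v`. -/
def shadow (G : SimpleGraph V) (x v : V) : Set V :=
  {w | G.dist x w = G.dist x v + G.dist v w}

theorem mem_shadow {x v w : V} :
    w ∈ shadow G x v ↔ G.dist x w = G.dist x v + G.dist v w :=
  Iff.rfl

theorem mem_shadow_of_adj (hG : G.Connected) {x v w y : V} (hadj : G.Adj w y)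
    (hd : G.dist x w + 1 = G.dist x y) (hw : w ∈ shadow G x v) : y ∈ shadow G x v := by
  refine le_antisymm hG.dist_triangle ?_
  have := dist_le_dist_add_one hG hadj.symm v
  rw [mem_shadow] at hw
  rw [G.dist_comm (u := v) (v := y), ← hd, hw, G.dist_comm (u := v) (v := w)]
  omega

theorem notMem_shadow_of_dist_lt {x v w : V} (h : G.dist x w < G.dist x v) :
    w ∉ shadow G x v := fun hw => by
  rw [mem_shadow] at hw
  omega

theorem shadow_ssubset_shadow (hG : G.Connected) {x u v : V} (hadj : G.Adj u v)
    (hd : G.dist x u + 1 = G.dist x v) : shadow G x v ⊂ shadow G x u := by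
  refine (Set.ssubset_iff_of_subset fun w hw => ?_).2
    ⟨u, by simp [mem_shadow], notMem_shadow_of_dist_lt (by omega)⟩
  refine le_antisymm hG.dist_triangle ?_
  have := dist_le_dist_add_one hG hadj w
  rw [mem_shadow] at hw
  omega

theorem exists_lt_ncard_shadow [Finite V] (hG : G.Connected) (x : V) {u : V} {r : ℕ}
    (hr : r ≤ G.dist x u) :
    ∃ v, G.dist x v + r = G.dist x u ∧ r < (shadow G x v).ncard := by
  induction r with
  | zero => exact ⟨u, rfl, (Set.ncard_pos (Set.toFinite _)).2 ⟨u, by simp [mem_shadow]⟩⟩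
  | succ r ih =>
    obtain ⟨v, hdist, hcard⟩ := ih (Nat.le_of_succ_le hr)
    have hvx : v ≠ x := by
      rintro rfl
      rw [dist_self] at hdist
      omega
    obtain ⟨v', hadj, hd⟩ := exists_adj_dist_add_one_eq hG hvx
    have hlt := Set.ncard_lt_ncard (shadow_ssubset_shadow hG hadj hd) (Set.toFinite _)
    exact ⟨v', by omega, by omega⟩

theorem connected_induce_compl_shadow (hG : G.Connected) {x v : V} (hv : v ≠ x) :
    (G.induce (shadow G x v)ᶜ).Connected := by
  refine connected_induce_of_exists_adj_dist_lt (x := x) ?_ fun w hw hwx => ?_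
  · exact notMem_shadow_of_dist_lt (by rw [dist_self]; exact hG.pos_dist_of_ne hv.symm)
  · obtain ⟨u, hadj, hd⟩ := exists_adj_dist_add_one_eq hG hwx
    exact ⟨u, fun hu => hw (mem_shadow_of_adj hG hadj hd hu), hadj, by omega⟩

theorem exists_ball_cover_or_connected_remainder [Finite V] (hG : G.Connected) (r : ℕ) :
    (∃ x, ∀ w, G.dist x w ≤ r) ∨
      ∃ (v : V) (S : Set V), (G.induce S).Connected ∧ S.ncard + r < Nat.card V ∧
        (∀ w ∉ S, G.dist v w ≤ r) ∧ ∃ u ∈ S, G.Adj v u := by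
  have := hG.nonempty
  obtain ⟨x⟩ := hG.nonempty
  obtain ⟨y, hmax⟩ := Finite.exists_max (G.dist x)
  obtain hy | hy := le_or_gt (G.dist x y) r
  · exact Or.inl ⟨x, fun w => (hmax w).trans hy⟩
  obtain ⟨v, hdist, hcard⟩ := exists_lt_ncard_shadow hG x hy.le
  have hvx : v ≠ x := by
    rintro rfl
    rw [dist_self] at hdist
    omega
  obtain ⟨u, hadj, hd⟩ := exists_adj_dist_add_one_eq hG hvx
  refine Or.inr ⟨v, (shadow G x v)ᶜ, connected_induce_compl_shadow hG hvx, ?_, fun w hw => ?_,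
    u, notMem_shadow_of_dist_lt (by omega), hadj.symm⟩
  · have := Set.ncard_add_ncard_compl (shadow G x v)
    omega
  · have hw : G.dist x w = G.dist x v + G.dist v w := not_not.1 hw
    have := hmax w
    omega

theorem exists_forall_dist_le_of_card_le [Finite V] (hG : G.Connected) {R : ℕ}
    (hcard : Nat.card V ≤ 2 * R + 1) : ∃ z, ∀ w, G.dist z w ≤ R := by
  obtain h | ⟨v, S, hS, hScard, hball, u, hu, hadj⟩ :=
    exists_ball_cover_or_connected_remainder hG R
  · exact h
  · refine ⟨v, fun w => ?_⟩
    by_cases hw : w ∈ S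
    · have hle : G.dist u w ≤ _ := dist_le_dist_induce hS ⟨u, hu⟩ ⟨w, hw⟩
      have hlt : (G.induce S).dist ⟨u, hu⟩ ⟨w, hw⟩ < S.ncard := dist_lt_card hS _ _
      have htri := dist_le_dist_add_one hG hadj w
      omega
    · exact hball w hw

theorem exists_ball_cover_of_card_le [Finite V] (hG : G.Connected) (j : ℕ) {R : ℕ}
    (hcard : 2 * Nat.card V ≤ j * (j + 1) + 2 * (2 * R + 1)) :
    ∃ (z : V) (c : ℕ → V), ∀ w, G.dist z w ≤ R ∨ ∃ i < j, G.dist (c i) w ≤ i := by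
  classical
  induction j generalizing V with
  | zero =>
    obtain ⟨z, hz⟩ := exists_forall_dist_le_of_card_le hG (R := R) (by omega)
    exact ⟨z, fun _ => z, fun w => Or.inl (hz w)⟩
  | succ j ih =>
    obtain ⟨x, hx⟩ | ⟨v, S, hS, hScard, hball, -⟩ := exists_ball_cover_or_connected_remainder hG j
    · exact ⟨x, fun _ => x, fun w => Or.inr ⟨j, j.lt_succ_self, hx w⟩⟩
    obtain ⟨z, c, hc⟩ := ih hS (by rw [Nat.card_coe_set_eq]; nlinarith)
    refine ⟨z, Function.update (fun i => c i) j v, fun w => ?_⟩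
    by_cases hw : w ∈ S
    · obtain hz | ⟨i, hi, hci⟩ := hc ⟨w, hw⟩
      · exact Or.inl ((dist_le_dist_induce hS z ⟨w, hw⟩).trans hz)
      · refine Or.inr ⟨i, hi.trans j.lt_succ_self, ?_⟩
        rw [Function.update_of_ne hi.ne]
        exact (dist_le_dist_induce hS (c i) ⟨w, hw⟩).trans hci
    · refine Or.inr ⟨j, j.lt_succ_self, ?_⟩
      rw [Function.update_self]
      exact hball w hw

theorem burningNumber_le_of_connected_dominating (hG : G.Connected) {S : Set V} [Finite S]
    (hS : (G.induce S).Connected) {d j : ℕ} (hdom : ∀ v, ∃ w ∈ S, G.dist w v ≤ d)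
    (hcard : 2 * S.ncard ≤ j * (j + 1) + 2 * (2 * j + 1)) : G.burningNumber ≤ d + j + 1 := by
  obtain ⟨z, c, hc⟩ := exists_ball_cover_of_card_le hS j hcard
  refine burningNumber_le_of_ball_cover hG (fun i => if i = d + j then z else c (i - d))
    fun v => ?_
  obtain ⟨w, hw, hwv⟩ := hdom v
  have hdist (y : S) : G.dist y v ≤ (G.induce S).dist y ⟨w, hw⟩ + d :=
    hG.dist_triangle.trans (add_le_add (dist_le_dist_induce hS y ⟨w, hw⟩) hwv)
  obtain hz | ⟨i, hi, hci⟩ := hc ⟨w, hw⟩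
  · refine ⟨d + j, by omega, ?_⟩
    rw [if_pos rfl]
    have := hdist z
    omega
  · refine ⟨d + i, by omega, ?_⟩
    rw [if_neg (by omega), Nat.add_sub_cancel_left]
    have := hdist (c i)
    omega

end BallCovers

section Trees

theorem exists_adj_eq_or_neighborSet_nontrivial (hG : G.Connected) {x v : V} (hv : v ≠ x) :
    ∃ w, G.Adj w v ∧ (w = x ∨ (G.neighborSet w).Nontrivial) := by
  obtain ⟨w, hadj, hd⟩ := exists_adj_dist_add_one_eq hG hv
  refine ⟨w, hadj, or_iff_not_imp_left.2 fun hwx => ?_⟩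
  obtain ⟨u, hadj', hd'⟩ := exists_adj_dist_add_one_eq hG hwx
  refine ⟨u, hadj'.symm, v, hadj, ?_⟩
  rintro rfl
  omega

theorem exists_connected_dominating_ncard_le [Finite V] (hG : G.Connected) :
    ∃ S : Set V, (G.induce S).Connected ∧ (∀ v, ∃ w ∈ S, G.dist w v ≤ 1) ∧
      S.ncard ≤ max 1 {v | (G.neighborSet v).Nontrivial}.ncard := by
  set A : Set V := {v | (G.neighborSet v).Nontrivial}
  obtain hA | ⟨x, hx⟩ := A.eq_empty_or_nonempty
  · obtain ⟨x⟩ := hG.nonempty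
    refine ⟨{x}, by simp, fun v => ⟨x, rfl, ?_⟩, by simp⟩
    obtain rfl | hv := eq_or_ne v x
    · simp
    · obtain ⟨w, hadj, rfl | hw⟩ := exists_adj_eq_or_neighborSet_nontrivial hG hv
      · exact (dist_eq_one_iff_adj.2 hadj).le
      · exact absurd hw (Set.eq_empty_iff_forall_notMem.1 hA w)
  · have hpre : (G.induce A).Preconnected :=
      hG.preconnected.induce_of_degree_eq_one fun v hv => Set.not_nontrivial_iff.1 hv
    refine ⟨A, (connected_iff _).2 ⟨hpre, ⟨x, hx⟩⟩, fun v => ?_, le_max_right _ _⟩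
    obtain rfl | hv := eq_or_ne v x
    · exact ⟨v, hx, by simp⟩
    · obtain ⟨w, hadj, hw⟩ := exists_adj_eq_or_neighborSet_nontrivial hG hv
      exact ⟨w, hw.elim (fun h => h ▸ hx) id, (dist_eq_one_iff_adj.2 hadj).le⟩

theorem burningNumber_le_of_connected [Finite V] (hG : G.Connected) {k : ℕ}
    (hk : 2 * ({v | (G.neighborSet v).Nontrivial}.ncard + 1) < k * (k + 1)) :
    G.burningNumber ≤ k := by
  obtain ⟨S, hS, hdom, hcard⟩ := exists_connected_dominating_ncard_le hG
  obtain ⟨j, rfl⟩ : ∃ j, k = 1 + j + 1 := by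
    refine ⟨k - 2, ?_⟩
    have : 1 < k := by
      by_contra!
      interval_cases k <;> omega
    omega
  refine burningNumber_le_of_connected_dominating hG hS hdom ?_
  obtain ⟨q, hq⟩ := Nat.even_mul_succ_self j
  have : (1 + j + 1) * (1 + j + 1 + 1) = j * (j + 1) + 4 * j + 6 := by ring
  omega

theorem two_le_degree_iff {v : V} [Fintype (G.neighborSet v)] :
    2 ≤ G.degree v ↔ (G.neighborSet v).Nontrivial := by
  rw [← card_neighborFinset_eq_degree, Nat.succ_le_iff, Finset.one_lt_card_iff_nontrivial,
    Finset.Nontrivial, coe_neighborFinset]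

variable [Fintype V] [DecidableRel G.Adj]

theorem sum_degree_add_two (hG : G.IsTree) : ∑ v, G.degree v + 2 = 2 * Fintype.card V := by
  classical
  rw [G.sum_degrees_eq_twice_card_edges, ← hG.card_edgeFinset]
  ring

theorem two_mul_ncard_nontrivial_add_one_le [Nontrivial V] (hG : G.IsTree) :
    2 * ({v | (G.neighborSet v).Nontrivial}.ncard + 1) ≤
      Fintype.card V + ({v | G.degree v = 2} : Finset V).card := by
  have hpointwise (v : V) : 2 + 2 * (if 2 ≤ G.degree v then 1 else 0) ≤
      1 + (if G.degree v = 2 then 1 else 0) + G.degree v := by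
    have := hG.connected.preconnected.degree_pos_of_nontrivial v
    split_ifs <;> omega
  have hsum := Finset.sum_le_sum fun v (_ : v ∈ Finset.univ) => hpointwise v
  simp only [Finset.sum_add_distrib, ← Finset.mul_sum, ← Finset.card_filter, Finset.sum_const,
    Finset.card_univ, smul_eq_mul] at hsum
  have hncard : {v | (G.neighborSet v).Nontrivial}.ncard =
      ({v | 2 ≤ G.degree v} : Finset V).card := by
    rw [← Set.ncard_coe_finset]
    simp only [two_le_degree_iff, Finset.coe_filter, Finset.mem_univ, true_and]
  have := sum_degree_add_two hG
  omega

theorem burningNumber_le_of_isTree (hG : G.IsTree) {k : ℕ}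
    (hk : Fintype.card V + ({v | G.degree v = 2} : Finset V).card < k * (k + 1)) :
    G.burningNumber ≤ k := by
  obtain hV | hV := subsingleton_or_nontrivial V
  · obtain ⟨x⟩ := hG.connected.nonempty
    have hk0 : 0 < k := Nat.pos_of_ne_zero (by rintro rfl; omega)
    exact burningNumber_le_of_ball_cover hG.connected (fun _ => x)
      fun v => ⟨0, hk0, by simp [Subsingleton.elim v x]⟩
  · exact burningNumber_le_of_connected hG.connected
      ((two_mul_ncard_nontrivial_add_one_le hG).trans_lt hk)

end Trees

section Arithmetic

theorem ceil_sqrt_sub_mul_ceil_sqrt_sub_add_one_lt {x : ℝ} (hx : 0 < x) :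
    (⌈√(x + 0.25) - 1.5⌉ : ℝ) * (⌈√(x + 0.25) - 1.5⌉ + 1) < x := by
  set t := ⌈√(x + 0.25) - 1.5⌉
  have hupper : (t : ℝ) + 0.5 < √(x + 0.25) := by
    have : (t : ℝ) < √(x + 0.25) - 1.5 + 1 := Int.ceil_lt_add_one _
    linarith
  have hlower : -√(x + 0.25) < t + 0.5 := by
    have hroot : 0.5 < √(x + 0.25) := Real.lt_sqrt_of_sq_lt (by linarith)
    have : √(x + 0.25) - 1.5 ≤ t := Int.le_ceil _
    linarith
  have hsq := sq_lt_sq' hlower hupper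
  rw [Real.sq_sqrt (by linarith)] at hsq
  linarith

theorem lt_mul_add_one_of_sub_le_sq {R : Type*} [CommRing R] [LinearOrder R]
    [IsStrictOrderedRing R] {N t K : R} (hK : 0 ≤ K) (ht : t * (t + 1) < N)
    (hsq : N - t ≤ K ^ 2) : N < K * (K + 1) := by
  have htK : t < K := by
    by_contra! hKt
    have := pow_le_pow_left₀ hK hKt 2
    linarith
  linarith

theorem lt_ceil_sqrt_mul_ceil_sqrt_add_one {N : ℕ} (hN : 0 < N) :
    (N : ℤ) < ⌈√((N : ℝ) - ⌈√((N : ℝ) + 0.25) - 1.5⌉)⌉ *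
      (⌈√((N : ℝ) - ⌈√((N : ℝ) + 0.25) - 1.5⌉)⌉ + 1) := by
  have ht := ceil_sqrt_sub_mul_ceil_sqrt_sub_add_one_lt (x := N) (by exact_mod_cast hN)
  set t := ⌈√((N : ℝ) + 0.25) - 1.5⌉
  have hK : 0 ≤ ⌈√((N : ℝ) - t)⌉ := Int.ceil_nonneg (Real.sqrt_nonneg _)
  have hsq : (N : ℝ) - t ≤ (⌈√((N : ℝ) - t)⌉ : ℝ) ^ 2 :=
    (Real.sqrt_le_left (by exact_mod_cast hK)).1 (Int.le_ceil _)
  exact lt_mul_add_one_of_sub_le_sq hK (by exact_mod_cast ht) (by exact_mod_cast hsq)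

end Arithmetic

end GraphBurning

theorem mainTheorem1 {V : Type*} [Fintype V] (T : SimpleGraph V) [DecidableRel T.Adj]
    (hT : T.IsTree) (n n₂ : ℕ) (hn : n = Fintype.card V)
    (hn₂ : n₂ = (Finset.univ.filter (fun v : V => T.degree v = 2)).card) :
    (T.burningNumber : ℤ) ≤
      ⌈((n : ℝ) + n₂ - ⌈Real.sqrt ((n : ℝ) + n₂ + 0.25) - 1.5⌉) ^ (1 / 2 : ℝ)⌉ := by
  have := hT.connected.nonempty
  have hpos : 0 < n + n₂ := Nat.add_pos_left (hn ▸ Fintype.card_pos) n₂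
  have hlt := GraphBurning.lt_ceil_sqrt_mul_ceil_sqrt_add_one hpos
  rw [Nat.cast_add (R := ℝ)] at hlt
  rw [← Real.sqrt_eq_rpow]
  obtain ⟨k, hk⟩ := Int.eq_ofNat_of_zero_le
    (Int.ceil_nonneg (Real.sqrt_nonneg ((n : ℝ) + n₂ - ⌈√((n : ℝ) + n₂ + 0.25) - 1.5⌉)))
  rw [hk] at hlt ⊢
  subst hn hn₂
  exact_mod_cast GraphBurning.burningNumber_le_of_isTree hT (by exact_mod_cast hlt)
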